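/- All spaces are over $\mathbb C$ and all (bi)linear maps are bounded. For a Banach algebra $\mathfrak A$ (not necessarily unital), a Banach right $\mathfrak A$-module $P$ and a Banach left $\mathfrak A$-module $Q$, let $P\widehat\otimes_{\mathfrak A}Q=(P\widehat\otimes Q)/N$, where $\widehat\otimes$ is the projective tensor product and $N$ is the closed linear span of the tensors $p.a\otimes q-p\otimes a.q$ ($p\in P$, $a\in\mathfrak A$, $q\in Q$). The Banach algebra $\mathfrak A$ is self-induced if multiplication implements an isomorphism $\mathfrak A\widehat\otimes_{\mathfrak A}\mathfrak A\to\mathfrak A$. Let $\mathfrak A$ and $\mathfrak B$ be self-induced Banach algebras. A Morita context $\mathfrak M(\mathfrak A,\mathfrak B,P,Q,\{\cdot,\cdot\},[\cdot,\cdot])$ consists of a Banach $\mathfrak A$-$\mathfrak B$-bimodule $P$, a Banach $\mathfrak B$-$\mathfrak A$-bimodule $Q$ and balanced bilinear maps $\{\cdot,\cdot\}\colon P\times Q\to\mathfrak A$ and $[\cdot,\cdot]\colon Q\times P\to\mathfrak B$ which implement bimodule homomorphisms $P\widehat\otimes_{\mathfrak B}Q\to\mathfrak A$ and $Q\widehat\otimes_{\mathfrak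 A}P\to\mathfrak B$ and satisfy $\{p,q\}p'=p[q,p']$ and $[q,p]q'=q\{p,q'\}$ for all $p,p'\in P$, $q,q'\in Q$. It is full if both homomorphisms are isomorphisms. Let $\mathcal Z^1(\mathfrak A,\mathfrak A^*)$ be the space of bounded derivations $D\colon\mathfrak A\to\mathfrak A^*$, $\mathcal B^1(\mathfrak A,\mathfrak A^*)$ the subspace of inner derivations $a\mapsto a.f-f.a$ ($f\in\mathfrak A^*$), where $\langle x,a.f\rangle=\langle xa,f\rangle$ and $\langle x,f.a\rangle=\langle ax,f\rangle$, and $\mathcal H^1(\mathfrak A,\mathfrak A^*)=\mathcal Z^1(\mathfrak A,\mathfrak A^*)/\mathcal B^1(\mathfrak A,\mathfrak A^*)$. Let $\mathcal Z^1_{\mathfrak M}(\mathfrak A,\mathfrak A^*)$ be the space of derivations $D\in\mathcal Z^1(\mathfrak A,\mathfrak A^*)$ for which there is a bounded bilinear form $\psi\colon P\times Q\to\mathbb C$ with $$\langle\{p,q\},D(a)\rangle=\psi(ap,q)-\psi(p,qa)\qquad(p\in P,\ q\in Q,\ a\in\mathfrak A).$$ It contains $\mathcal B^1(\mathfrak A,\mathfrak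 A^*)$; put $\mathcal H^1_{\mathfrak M}(\mathfrak A,\mathfrak A^*)=\mathcal Z^1_{\mathfrak M}(\mathfrak A,\mathfrak A^*)/\mathcal B^1(\mathfrak A,\mathfrak A^*)\subseteq\mathcal H^1(\mathfrak A,\mathfrak A^*)$. Define $\mathcal H^1_{\mathfrak M}(\mathfrak B,\mathfrak B^*)\subseteq\mathcal H^1(\mathfrak B,\mathfrak B^*)$ analogously, by derivations $D\colon\mathfrak B\to\mathfrak B^*$ with $\langle[q,p],D(b)\rangle=\psi(bq,p)-\psi(q,pb)$ for some bounded bilinear form $\psi$ on $Q\times P$. **Theorem.** Let $\mathfrak M(\mathfrak A,\mathfrak B,P,Q,\dots)$ be a full Morita context of self-induced Banach algebras. Then $$\mathcal H^1_{\mathfrak M}(\mathfrak A,\mathfrak A^*)\cong\mathcal H^1_{\mathfrak M}(\mathfrak B,\mathfrak B^*)$$ as complex vector spaces. -/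

import Mathlib

set_option maxSynthPendingDepth 3
set_option linter.unusedSectionVars false
set_option linter.checkUnivs false

noncomputable section

open scoped TensorProduct

namespace MoritaInvariance

universe u v w x

/-! ### The projective tensor product of Banach spaces -/

section ProjectiveTensorProduct

variable (E : Type u) (F : Type v) [NormedAddCommGroup E] [NormedSpace ℂ E]
  [NormedAddCommGroup F] [NormedSpace ℂ F]

/-- The algebraic tensor product over `ℂ`, to be equipped with the projective norm. -/
def PreTensor : Type (max u v) := E ⊗[ℂ] F

instance : AddCommGroup (PreTensor E F) := inferInstanceAs (AddCommGroup (E ⊗[ℂ] F))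

instance : Module ℂ (PreTensor E F) := inferInstanceAs (Module ℂ (E ⊗[ℂ] F))

variable {E F}

/-- The elementary tensor in the algebraic tensor product. -/
def PreTensor.tmul (p : E) (q : F) : PreTensor E F := (p ⊗ₜ[ℂ] q : E ⊗[ℂ] F)

/-- The tensor `∑ p_i ⊗ q_i` represented by a finite list of pairs `(p_i, q_i)`. -/
def PreTensor.ofList (l : List (E × F)) : PreTensor E F :=
  (l.map fun z => PreTensor.tmul z.1 z.2).sum

/-- The sum `∑ ‖p_i‖ ‖q_i‖` attached to a finite list of pairs `(p_i, q_i)`. -/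
def listCost (l : List (E × F)) : ℝ := (l.map fun z => ‖z.1‖ * ‖z.2‖).sum

/-- The projective norm: the infimum of `∑ ‖p_i‖ ‖q_i‖` over all finite representations
`t = ∑ p_i ⊗ q_i`. -/
def projNorm (t : PreTensor E F) : ℝ :=
  sInf {r : ℝ | ∃ l : List (E × F), PreTensor.ofList l = t ∧ listCost l = r}

theorem listCost_nonneg (l : List (E × F)) : 0 ≤ listCost l := by
  apply List.sum_nonneg
  intro r hr
  obtain ⟨z, -, rfl⟩ := List.mem_map.1 hr
  positivity

theorem PreTensor.ofList_append (l₁ l₂ : List (E × F)) :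
    PreTensor.ofList (l₁ ++ l₂) = PreTensor.ofList l₁ + PreTensor.ofList l₂ := by
  simp [PreTensor.ofList]

theorem listCost_append (l₁ l₂ : List (E × F)) :
    listCost (l₁ ++ l₂) = listCost l₁ + listCost l₂ := by
  simp [listCost]

theorem PreTensor.ofList_smul (c : ℂ) (l : List (E × F)) :
    PreTensor.ofList (l.map fun z => (c • z.1, z.2)) = c • PreTensor.ofList l := by
  induction l with
  | nil => simp [PreTensor.ofList]
  | cons z l ih =>
    simp only [PreTensor.ofList, List.map_cons, List.sum_cons, smul_add] at ih ⊢
    rw [ih]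
    congr 1

theorem listCost_smul (c : ℂ) (l : List (E × F)) :
    listCost (l.map fun z => (c • z.1, z.2)) = ‖c‖ * listCost l := by
  induction l with
  | nil => simp [listCost]
  | cons z l ih =>
    simp only [listCost, List.map_cons, List.sum_cons] at ih ⊢
    rw [ih, norm_smul]
    ring

theorem PreTensor.exists_ofList (t : PreTensor E F) :
    ∃ l : List (E × F), PreTensor.ofList l = t := by
  refine TensorProduct.induction_on (motive := fun t : E ⊗[ℂ] F =>
    ∃ l : List (E × F), PreTensor.ofList l = t) t ⟨[], rfl⟩ ?_ ?_
  · intro p q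
    exact ⟨[(p, q)], List.sum_singleton⟩
  · rintro _ _ ⟨l₁, rfl⟩ ⟨l₂, rfl⟩
    exact ⟨l₁ ++ l₂, PreTensor.ofList_append l₁ l₂⟩

theorem projNorm_le (l : List (E × F)) : projNorm (PreTensor.ofList l) ≤ listCost l := by
  refine csInf_le ⟨0, ?_⟩ ⟨l, rfl, rfl⟩
  rintro _ ⟨l', -, rfl⟩
  exact listCost_nonneg l'

theorem le_projNorm {t : PreTensor E F} {r : ℝ}
    (h : ∀ l : List (E × F), PreTensor.ofList l = t → r ≤ listCost l) : r ≤ projNorm t := by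
  obtain ⟨l, hl⟩ := PreTensor.exists_ofList t
  refine le_csInf ⟨_, l, hl, rfl⟩ ?_
  rintro _ ⟨l', hl', rfl⟩
  exact h l' hl'

theorem projNorm_zero : projNorm (0 : PreTensor E F) = 0 :=
  le_antisymm (projNorm_le ([] : List (E × F))) (le_projNorm fun l _ => listCost_nonneg l)

theorem projNorm_add_le (s t : PreTensor E F) : projNorm (s + t) ≤ projNorm s + projNorm t := by
  rw [← sub_le_iff_le_add]
  refine le_projNorm fun l₁ h₁ => ?_
  rw [sub_le_comm]
  refine le_projNorm fun l₂ h₂ => ?_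
  rw [sub_le_iff_le_add', ← h₁, ← h₂, ← PreTensor.ofList_append, ← listCost_append]
  exact projNorm_le (l₁ ++ l₂)

theorem projNorm_smul_le (c : ℂ) (t : PreTensor E F) : projNorm (c • t) ≤ ‖c‖ * projNorm t := by
  by_cases hc : c = 0
  · rw [hc, zero_smul, projNorm_zero, norm_zero, zero_mul]
  · have hc' : 0 < ‖c‖ := norm_pos_iff.2 hc
    have key : ‖c‖⁻¹ * projNorm (c • t) ≤ projNorm t := by
      refine le_projNorm fun l hl => ?_
      have h := projNorm_le (l.map fun z => (c • z.1, z.2))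
      rw [PreTensor.ofList_smul, listCost_smul, hl] at h
      exact (inv_mul_le_iff₀ hc').2 h
    exact (inv_mul_le_iff₀ hc').1 key

variable (E F)

/-- The projective norm as a seminorm. -/
def projSeminorm : Seminorm ℂ (PreTensor E F) :=
  Seminorm.ofSMulLE projNorm projNorm_zero projNorm_add_le projNorm_smul_le

instance : SeminormedAddCommGroup (PreTensor E F) :=
  (projSeminorm E F).toAddGroupSeminorm.toSeminormedAddCommGroup

instance : NormedSpace ℂ (PreTensor E F) where
  norm_smul_le c t := (map_smul_eq_mul (projSeminorm E F) c t).le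

/-- The projective tensor product `E ⊗̂ F`: the completion of the algebraic tensor product in the
projective norm. -/
abbrev ProjTensor : Type (max u v) := UniformSpace.Completion (PreTensor E F)

variable {E F}

/-- The elementary tensor `p ⊗ q` in the projective tensor product. -/
def ProjTensor.tmul (p : E) (q : F) : ProjTensor E F :=
  ((PreTensor.tmul p q : PreTensor E F) : UniformSpace.Completion (PreTensor E F))

end ProjectiveTensorProduct

/-! ### The balanced projective tensor product `P ⊗̂_A Q` -/

section BalancedTensor

variable {A : Type u} {P : Type v} {Q : Type w} {Z : Type x}
  [NonUnitalNormedRing A] [NormedSpace ℂ A]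
  [NormedAddCommGroup P] [NormedSpace ℂ P] [NormedAddCommGroup Q] [NormedSpace ℂ Q]
  [NormedAddCommGroup Z] [NormedSpace ℂ Z]

/-- The closed linear span of the tensors `p.a ⊗ q - p ⊗ a.q`. -/
def balancingSubspace (r : P →L[ℂ] A →L[ℂ] P) (l : A →L[ℂ] Q →L[ℂ] Q) :
    Submodule ℂ (ProjTensor P Q) :=
  (Submodule.span ℂ {t | ∃ (p : P) (a : A) (q : Q),
    t = ProjTensor.tmul (r p a) q - ProjTensor.tmul p (l a q)}).topologicalClosure

/-- `P ⊗̂_A Q`, for a right action `r` of `A` on `P` and a left action `l` of `A` on `Q`. -/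
abbrev BalancedTensor (r : P →L[ℂ] A →L[ℂ] P) (l : A →L[ℂ] Q →L[ℂ] Q) : Type (max v w) :=
  ProjTensor P Q ⧸ balancingSubspace r l

/-- The class of `p ⊗ q` in `P ⊗̂_A Q`. -/
def BalancedTensor.tmul (r : P →L[ℂ] A →L[ℂ] P) (l : A →L[ℂ] Q →L[ℂ] Q) (p : P) (q : Q) :
    BalancedTensor r l :=
  (balancingSubspace r l).mkQ (ProjTensor.tmul p q)

/-- The bilinear map `φ : P × Q → Z` implements an isomorphism `P ⊗̂_A Q → Z`, that is, a linear
homeomorphism which sends `p ⊗ q` to `φ p q` (there is at most one such, the elementary tensors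
having dense linear span). If `φ` respects further module actions on `P`, `Q` and `Z`, then so
do this map and its inverse. -/
def ImplementsIso (r : P →L[ℂ] A →L[ℂ] P) (l : A →L[ℂ] Q →L[ℂ] Q) (φ : P →L[ℂ] Q →L[ℂ] Z) :
    Prop :=
  ∃ e : BalancedTensor r l ≃L[ℂ] Z, ∀ p q, e (BalancedTensor.tmul r l p q) = φ p q

end BalancedTensor

/-- A Banach algebra `A` is self-induced if multiplication implements an isomorphism
`A ⊗̂_A A → A`. -/
def IsSelfInduced (A : Type u) [NonUnitalNormedRing A] [NormedSpace ℂ A]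
    [IsScalarTower ℂ A A] [SMulCommClass ℂ A A] : Prop :=
  ImplementsIso (ContinuousLinearMap.mul ℂ A) (ContinuousLinearMap.mul ℂ A)
    (ContinuousLinearMap.mul ℂ A)

/-! ### Banach bimodules and Morita contexts -/

/-- The structure of a Banach `A`-`B`-bimodule on `P`: commuting, associative, bounded bilinear
actions of `A` on the left and of `B` on the right. -/
structure BanachBimodule (A : Type u) (B : Type v) (P : Type w)
    [NonUnitalNormedRing A] [NormedSpace ℂ A] [NonUnitalNormedRing B] [NormedSpace ℂ B]
    [NormedAddCommGroup P] [NormedSpace ℂ P] where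
  /-- the left action `(a, p) ↦ a.p` -/
  left : A →L[ℂ] P →L[ℂ] P
  /-- the right action `(p, b) ↦ p.b` -/
  right : P →L[ℂ] B →L[ℂ] P
  mul_left : ∀ (a a' : A) (p : P), left (a * a') p = left a (left a' p)
  right_mul : ∀ (p : P) (b b' : B), right p (b * b') = right (right p b) b'
  left_right : ∀ (a : A) (p : P) (b : B), right (left a p) b = left a (right p b)

/-- The bimodules and pairings of a Morita context over the Banach algebras `A` and `B`. -/
structure MoritaContext (A : Type u) (B : Type v) (P : Type w) (Q : Type x)
    [NonUnitalNormedRing A] [NormedSpace ℂ A] [NonUnitalNormedRing B] [NormedSpace ℂ B]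
    [NormedAddCommGroup P] [NormedSpace ℂ P] [NormedAddCommGroup Q] [NormedSpace ℂ Q] where
  /-- `P` is a Banach `A`-`B`-bimodule. -/
  modP : BanachBimodule A B P
  /-- `Q` is a Banach `B`-`A`-bimodule. -/
  modQ : BanachBimodule B A Q
  /-- the pairing `{p, q}` -/
  pairA : P →L[ℂ] Q →L[ℂ] A
  /-- the pairing `[q, p]` -/
  pairB : Q →L[ℂ] P →L[ℂ] B
  /-- `{p.b, q} = {p, b.q}` -/
  pairA_balanced : ∀ p b q, pairA (modP.right p b) q = pairA p (modQ.left b q)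
  /-- `[q.a, p] = [q, a.p]` -/
  pairB_balanced : ∀ q a p, pairB (modQ.right q a) p = pairB q (modP.left a p)
  /-- `{a.p, q} = a {p, q}` -/
  pairA_left : ∀ a p q, pairA (modP.left a p) q = a * pairA p q
  /-- `{p, q.a} = {p, q} a` -/
  pairA_right : ∀ p q a, pairA p (modQ.right q a) = pairA p q * a
  /-- `[b.q, p] = b [q, p]` -/
  pairB_left : ∀ b q p, pairB (modQ.left b q) p = b * pairB q p
  /-- `[q, p.b] = [q, p] b` -/
  pairB_right : ∀ q p b, pairB q (modP.right p b) = pairB q p * b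
  /-- `{p, q}.p' = p.[q, p']` -/
  compatP : ∀ p q p', modP.left (pairA p q) p' = modP.right p (pairB q p')
  /-- `[q, p].q' = q.{p, q'}` -/
  compatQ : ∀ q p q', modQ.left (pairB q p) q' = modQ.right q (pairA p q')

namespace MoritaContext

variable {A : Type u} {B : Type v} {P : Type w} {Q : Type x}
  [NonUnitalNormedRing A] [NormedSpace ℂ A] [NonUnitalNormedRing B] [NormedSpace ℂ B]
  [NormedAddCommGroup P] [NormedSpace ℂ P] [NormedAddCommGroup Q] [NormedSpace ℂ Q]

/-- The same context with the roles of `A, P` and `B, Q` interchanged. -/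
def symm (M : MoritaContext A B P Q) : MoritaContext B A Q P where
  modP := M.modQ
  modQ := M.modP
  pairA := M.pairB
  pairB := M.pairA
  pairA_balanced := M.pairB_balanced
  pairB_balanced := M.pairA_balanced
  pairA_left := M.pairB_left
  pairA_right := M.pairB_right
  pairB_left := M.pairA_left
  pairB_right := M.pairA_right
  compatP := M.compatQ
  compatQ := M.compatP

/-- The context is full: the pairings implement isomorphisms `P ⊗̂_B Q → A` and
`Q ⊗̂_A P → B`. -/
structure IsFull (M : MoritaContext A B P Q) : Prop where
  isoA : ImplementsIso M.modP.right M.modQ.left M.pairA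
  isoB : ImplementsIso M.modQ.right M.modP.left M.pairB

end MoritaContext

/-! ### Derivations into the dual and first cohomology

The dual `A*` carries the actions `⟨x, a.f⟩ = ⟨x a, f⟩` and `⟨x, f.a⟩ = ⟨a x, f⟩`; below,
`D a x` stands for `⟨x, D(a)⟩`. -/

section Cohomology

variable (A : Type u) [NonUnitalNormedRing A] [NormedSpace ℂ A]

/-- The bounded derivations `D : A → A*`, `D(ab) = a.D(b) + D(a).b`. -/
def Z1 : Submodule ℂ (A →L[ℂ] StrongDual ℂ A) where
  carrier := {D | ∀ a b x : A, D (a * b) x = D b (x * a) + D a (b * x)}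
  zero_mem' := by intro a b x; simp
  add_mem' := by
    intro D D' h h' a b x
    simp only [_root_.add_apply, h a b x, h' a b x]
    ring
  smul_mem' := by
    intro c D h a b x
    simp only [_root_.smul_apply, h a b x, smul_add]

/-- The inner derivations `a ↦ a.f - f.a`, for `f` in `A*`. -/
def B1 : Submodule ℂ (A →L[ℂ] StrongDual ℂ A) where
  carrier := {D | ∃ f : StrongDual ℂ A, ∀ a x : A, D a x = f (x * a) - f (a * x)}
  zero_mem' := ⟨0, by intro a x; simp⟩
  add_mem' := by
    rintro D D' ⟨f, hf⟩ ⟨g, hg⟩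
    refine ⟨f + g, fun a x => ?_⟩
    simp only [_root_.add_apply, hf a x, hg a x]
    ring
  smul_mem' := by
    rintro c D ⟨f, hf⟩
    refine ⟨c • f, fun a x => ?_⟩
    simp only [_root_.smul_apply, hf a x, smul_sub]

theorem B1_le_Z1 : B1 A ≤ Z1 A := by
  rintro D ⟨f, hf⟩ a b x
  simp only [hf, mul_assoc]
  ring

/-- The first bounded cohomology group of `A` with coefficients in `A*`: bounded derivations
modulo inner derivations. -/
abbrev H1 : Type u := ↥(Z1 A) ⧸ (B1 A).submoduleOf (Z1 A)

variable {A} {B : Type v} {P : Type w} {Q : Type x}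
  [NonUnitalNormedRing B] [NormedSpace ℂ B]
  [NormedAddCommGroup P] [NormedSpace ℂ P] [NormedAddCommGroup Q] [NormedSpace ℂ Q]

/-- The derivations `D : A → A*` such that `⟨{p, q}, D(a)⟩ = ψ(a.p, q) - ψ(p, q.a)` for some
bounded bilinear form `ψ` on `P × Q`. -/
def MoritaContext.Z1M (M : MoritaContext A B P Q) : Submodule ℂ (A →L[ℂ] StrongDual ℂ A) where
  carrier := {D | D ∈ Z1 A ∧ ∃ ψ : P →L[ℂ] Q →L[ℂ] ℂ, ∀ (p : P) (q : Q) (a : A),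
    D a (M.pairA p q) = ψ (M.modP.left a p) q - ψ p (M.modQ.right q a)}
  zero_mem' := ⟨(Z1 A).zero_mem, 0, by intro p q a; simp⟩
  add_mem' := by
    rintro D D' ⟨hD, ψ, hψ⟩ ⟨hD', ψ', hψ'⟩
    refine ⟨(Z1 A).add_mem hD hD', ψ + ψ', fun p q a => ?_⟩
    simp only [_root_.add_apply, hψ p q a, hψ' p q a]
    ring
  smul_mem' := by
    rintro c D ⟨hD, ψ, hψ⟩
    refine ⟨(Z1 A).smul_mem c hD, c • ψ, fun p q a => ?_⟩
    simp only [_root_.smul_apply, hψ p q a, smul_sub]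

theorem MoritaContext.B1_le_Z1M (M : MoritaContext A B P Q) : B1 A ≤ M.Z1M := by
  intro D hD
  refine ⟨B1_le_Z1 A hD, ?_⟩
  obtain ⟨f, hf⟩ := hD
  refine ⟨-((ContinuousLinearMap.compL ℂ Q A ℂ f).comp M.pairA), fun p q a => ?_⟩
  simp only [hf, _root_.neg_apply, ContinuousLinearMap.comp_apply,
    ContinuousLinearMap.compL_apply, M.pairA_left, M.pairA_right]
  ring

/-- The subspace of the first cohomology of `A` formed by the classes of the derivations in
`M.Z1M`; as `M.Z1M` contains the inner derivations, it is the quotient of `M.Z1M` by them. For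
the second algebra `B` of the context, use `M.symm.H1M`. -/
def MoritaContext.H1M (M : MoritaContext A B P Q) : Submodule ℂ (H1 A) :=
  (M.Z1M.submoduleOf (Z1 A)).map ((B1 A).submoduleOf (Z1 A)).mkQ

end Cohomology

end MoritaInvariance

end

/-!
The space `H1M` admits a description in which the two algebras play the same role. If `D` and `ψ`
satisfy `⟨{p, q}, D(a)⟩ = ψ(a.p, q) - ψ(p, q.a)`, then, the pairing being balanced over `B`,
`ψ(a.p.b, q) - ψ(p.b, q.a) = ψ(a.p, b.q) - ψ(p, b.q.a)`. This condition on `ψ` (membership in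
`MoritaContext.potentials`) does not change when `A, P` and `B, Q` are interchanged and `ψ` is
replaced by its flip. Conversely, it says that `(p, q) ↦ ψ(a.p, q) - ψ(p, q.a)` is balanced over
`B`, hence, as `P ⊗̂_B Q → A` is an isomorphism, every potential `ψ` comes from a unique bounded
`D : A → A*`, which is a derivation (`MoritaContext.derivOfPotential`). So the potentials map
linearly onto `H1M` (`MoritaContext.range_classOfPotential`).

The derivation `D` is inner, implemented by `f`, exactly when `ψ + f({·, ·})` is balanced over `A`;
as `Q ⊗̂_A P → B` is an isomorphism, this means that `ψ + f({·, ·}) = g([·, ·])` for some `g` in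
`B*`. The kernel of the map onto `H1M` therefore consists of the forms `f({·, ·}) + g([·, ·])`
(`MoritaContext.mem_ker_classOfPotential`), and this too is symmetric in `A` and `B`. Flipping
potentials thus induces an isomorphism between the two quotients. (On derivations this is, up to
sign, the transfer of a derivation of `A` to `B` through a derivation of the linking algebra.)

The analytic input is the universal property of the balanced projective tensor product:
`ImplementsIso.exists_lift` and `ImplementsIso.ext`.
-/

noncomputable section

namespace MoritaInvariance

universe u v w x y

/-! ### Universal property of the balanced projective tensor product -/

section UniversalProperty

variable {A : Type u} {P : Type v} {Q : Type w} {Z : Type x} {W : Type y}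
  [NonUnitalNormedRing A] [NormedSpace ℂ A]
  [NormedAddCommGroup P] [NormedSpace ℂ P] [NormedAddCommGroup Q] [NormedSpace ℂ Q]
  [NormedAddCommGroup Z] [NormedSpace ℂ Z] [NormedAddCommGroup W] [NormedSpace ℂ W]

/-- The linear map on the algebraic tensor product induced by a bounded bilinear map. -/
def PreTensor.liftLinear (φ : P →L[ℂ] Q →L[ℂ] W) : PreTensor P Q →ₗ[ℂ] W :=
  TensorProduct.lift (LinearMap.mk₂ ℂ (fun p q => φ p q) (by simp) (by simp) (by simp) (by simp))

theorem PreTensor.liftLinear_tmul (φ : P →L[ℂ] Q →L[ℂ] W) (p : P) (q : Q) :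
    PreTensor.liftLinear φ (PreTensor.tmul p q) = φ p q :=
  TensorProduct.lift.tmul p q

theorem PreTensor.norm_liftLinear_le (φ : P →L[ℂ] Q →L[ℂ] W) (t : PreTensor P Q) :
    ‖PreTensor.liftLinear φ t‖ ≤ ‖φ‖ * ‖t‖ := by
  have hlist (l : List (P × Q)) :
      ‖PreTensor.liftLinear φ (PreTensor.ofList l)‖ ≤ ‖φ‖ * listCost l := by
    induction l with
    | nil => simp [PreTensor.ofList, listCost]
    | cons z l ih =>
      simp only [PreTensor.ofList, listCost, List.map_cons, List.sum_cons, map_add,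
        liftLinear_tmul, mul_add] at ih ⊢
      refine (norm_add_le _ _).trans (add_le_add ?_ ih)
      rw [← mul_assoc]
      exact φ.le_opNorm₂ z.1 z.2
  change _ ≤ ‖φ‖ * projNorm t
  rcases (norm_nonneg φ).eq_or_lt with h0 | hpos
  · obtain ⟨l, rfl⟩ := PreTensor.exists_ofList t
    have h := hlist l
    rwa [← h0, zero_mul] at h ⊢
  · rw [← inv_mul_le_iff₀ hpos]
    refine le_projNorm fun l hl => ?_
    rw [inv_mul_le_iff₀ hpos, ← hl]
    exact hlist l

/-- The bounded linear map on `P ⊗̂ Q` induced by a bounded bilinear map. -/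
def ProjTensor.lift [CompleteSpace W] (φ : P →L[ℂ] Q →L[ℂ] W) : ProjTensor P Q →L[ℂ] W :=
  ((PreTensor.liftLinear φ).mkContinuous ‖φ‖ (PreTensor.norm_liftLinear_le φ)).fromCompletion

theorem ProjTensor.lift_tmul [CompleteSpace W] (φ : P →L[ℂ] Q →L[ℂ] W) (p : P) (q : Q) :
    ProjTensor.lift φ (ProjTensor.tmul p q) = φ p q := by
  rw [ProjTensor.lift, ProjTensor.tmul, ContinuousLinearMap.fromCompletion_apply_coe]
  exact PreTensor.liftLinear_tmul φ p q

theorem ProjTensor.ext {S T : ProjTensor P Q →L[ℂ] W}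
    (h : ∀ p q, S (ProjTensor.tmul p q) = T (ProjTensor.tmul p q)) : S = T := by
  ext t
  induction t using UniformSpace.Completion.induction_on with
  | hp => exact isClosed_eq S.continuous T.continuous
  | ih t =>
    obtain ⟨l, rfl⟩ := PreTensor.exists_ofList t
    induction l with
    | nil =>
      change S ((0 : PreTensor P Q) : ProjTensor P Q) = T ((0 : PreTensor P Q) : ProjTensor P Q)
      rw [UniformSpace.Completion.coe_zero, map_zero, map_zero]
    | cons z l ih =>
      simp only [PreTensor.ofList, List.map_cons, List.sum_cons] at ih ⊢
      rw [UniformSpace.Completion.coe_add, map_add, map_add, ih]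
      congr 1
      exact h z.1 z.2

variable {r : P →L[ℂ] A →L[ℂ] P} {l : A →L[ℂ] Q →L[ℂ] Q} {φ : P →L[ℂ] Q →L[ℂ] Z}

/-- If `φ` implements an isomorphism `P ⊗̂_A Q → Z`, then every balanced bounded bilinear map on
`P × Q` factors through `φ`. -/
theorem ImplementsIso.exists_lift [CompleteSpace W] (h : ImplementsIso r l φ)
    (θ : P →L[ℂ] Q →L[ℂ] W) (hθ : ∀ p a q, θ (r p a) q = θ p (l a q)) :
    ∃ T : Z →L[ℂ] W, ∀ p q, T (φ p q) = θ p q := by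
  obtain ⟨e, he⟩ := h
  have hker : balancingSubspace r l ≤ (ProjTensor.lift θ).ker := by
    refine Submodule.topologicalClosure_minimal _ ?_ (ProjTensor.lift θ).isClosed_ker
    rw [Submodule.span_le]
    rintro _ ⟨p, a, q, rfl⟩
    simp [ProjTensor.lift_tmul, hθ]
  refine ⟨((balancingSubspace r l).liftQL (ProjTensor.lift θ) hker).comp
    (e.symm : Z →L[ℂ] BalancedTensor r l), fun p q => ?_⟩
  rw [← he]
  simp only [ContinuousLinearMap.comp_apply, ContinuousLinearEquiv.coe_coe,
    ContinuousLinearEquiv.symm_apply_apply]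
  exact ProjTensor.lift_tmul θ p q

/-- If `φ` implements an isomorphism `P ⊗̂_A Q → Z`, then bounded linear maps on `Z` are determined
by their values on the range of `φ`. -/
theorem ImplementsIso.ext (h : ImplementsIso r l φ) {S T : Z →L[ℂ] W}
    (hST : ∀ p q, S (φ p q) = T (φ p q)) : S = T := by
  obtain ⟨e, he⟩ := h
  have hcomp : (S.comp (e : BalancedTensor r l →L[ℂ] Z)).comp (balancingSubspace r l).mkQL =
      (T.comp (e : BalancedTensor r l →L[ℂ] Z)).comp (balancingSubspace r l).mkQL := by
    refine ProjTensor.ext fun p q => ?_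
    change S (e (BalancedTensor.tmul r l p q)) = T (e (BalancedTensor.tmul r l p q))
    rw [he, hST]
  ext z
  obtain ⟨t, ht⟩ := (balancingSubspace r l).mkQ_surjective (e.symm z)
  have := DFunLike.congr_fun hcomp t
  change S (e ((balancingSubspace r l).mkQ t)) = T (e ((balancingSubspace r l).mkQ t)) at this
  simpa only [ht, ContinuousLinearEquiv.apply_symm_apply] using this

end UniversalProperty

/-! ### Potentials and their derivations -/

namespace MoritaContext

variable {A : Type u} {B : Type v} {P : Type w} {Q : Type x}
  [NonUnitalNormedRing A] [NormedSpace ℂ A] [NonUnitalNormedRing B] [NormedSpace ℂ B]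
  [NormedAddCommGroup P] [NormedSpace ℂ P] [NormedAddCommGroup Q] [NormedSpace ℂ Q]
  (M : MoritaContext A B P Q)

/-- The bounded bilinear forms `ψ` on `P × Q` such that
`ψ(a.p.b, q) - ψ(p.b, q.a) = ψ(a.p, b.q) - ψ(p, b.q.a)`, that is, such that
`(p, q) ↦ ψ(a.p, q) - ψ(p, q.a)` is balanced over `B` for every `a`. -/
def potentials : Submodule ℂ (P →L[ℂ] Q →L[ℂ] ℂ) where
  carrier := {ψ | ∀ (a : A) (b : B) (p : P) (q : Q),
    ψ (M.modP.left a (M.modP.right p b)) q - ψ (M.modP.right p b) (M.modQ.right q a) =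
      ψ (M.modP.left a p) (M.modQ.left b q) - ψ p (M.modQ.left b (M.modQ.right q a))}
  zero_mem' := by intro a b p q; simp
  add_mem' := by
    intro ψ ψ' h h' a b p q
    simp only [_root_.add_apply]
    linear_combination h a b p q + h' a b p q
  smul_mem' := by
    intro c ψ h a b p q
    simp only [_root_.smul_apply, smul_eq_mul]
    linear_combination c * h a b p q

theorem flip_mem_potentials {ψ : P →L[ℂ] Q →L[ℂ] ℂ} (h : ψ ∈ M.potentials) :
    ψ.flip ∈ M.symm.potentials := by
  intro b a q p
  have := h a b p q
  simp only [symm, ContinuousLinearMap.flip_apply]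
  linear_combination this

/-- Flipping bilinear forms identifies the potentials of `M` with those of `M.symm`. -/
def potentialsFlip : M.potentials ≃ₗ[ℂ] M.symm.potentials where
  toFun ψ := ⟨ψ.1.flip, M.flip_mem_potentials ψ.2⟩
  invFun ψ := ⟨ψ.1.flip, M.symm.flip_mem_potentials ψ.2⟩
  map_add' _ _ := rfl
  map_smul' _ _ := rfl
  left_inv _ := rfl
  right_inv _ := rfl

/-- The bilinear map `P × Q → A*` which sends `(p, q)` to `a ↦ ψ(a.p, q) - ψ(p, q.a)`. -/
def commutatorForm (ψ : P →L[ℂ] Q →L[ℂ] ℂ) : P →L[ℂ] Q →L[ℂ] StrongDual ℂ A :=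
  (ContinuousLinearMap.flipₗᵢ ℂ A Q ℂ : (A →L[ℂ] Q →L[ℂ] ℂ) →L[ℂ] (Q →L[ℂ] A →L[ℂ] ℂ)).comp
      ((ContinuousLinearMap.compL ℂ A P (Q →L[ℂ] ℂ) ψ).comp M.modP.left.flip) -
    ((ContinuousLinearMap.compL ℂ Q (A →L[ℂ] Q) (A →L[ℂ] ℂ)).flip M.modQ.right).comp
      ((ContinuousLinearMap.compL ℂ A Q ℂ).comp ψ)

theorem commutatorForm_apply (ψ : P →L[ℂ] Q →L[ℂ] ℂ) (p : P) (q : Q) (a : A) :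
    M.commutatorForm ψ p q a = ψ (M.modP.left a p) q - ψ p (M.modQ.right q a) := rfl

variable {M}

theorem IsFull.symm (hM : M.IsFull) : M.symm.IsFull := ⟨hM.isoB, hM.isoA⟩

theorem IsFull.exists_deriv (hM : M.IsFull) (ψ : M.potentials) :
    ∃ D : A →L[ℂ] StrongDual ℂ A, ∀ p q a, D a (M.pairA p q) =
      ψ.1 (M.modP.left a p) q - ψ.1 p (M.modQ.right q a) := by
  obtain ⟨T, hT⟩ := hM.isoA.exists_lift (M.commutatorForm ψ.1) (by
    intro p b q
    ext a
    rw [M.commutatorForm_apply, M.commutatorForm_apply, ψ.2 a b p q, M.modQ.left_right])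
  exact ⟨T.flip, fun p q a => by
    rw [ContinuousLinearMap.flip_apply, hT, M.commutatorForm_apply]⟩

/-- The derivation `D : A → A*` with `⟨{p, q}, D(a)⟩ = ψ(a.p, q) - ψ(p, q.a)`. -/
def derivOfPotential (hM : M.IsFull) (ψ : M.potentials) : A →L[ℂ] StrongDual ℂ A :=
  (hM.exists_deriv ψ).choose

theorem derivOfPotential_apply (hM : M.IsFull) (ψ : M.potentials) (p : P) (q : Q) (a : A) :
    derivOfPotential hM ψ a (M.pairA p q) =
      ψ.1 (M.modP.left a p) q - ψ.1 p (M.modQ.right q a) :=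
  (hM.exists_deriv ψ).choose_spec p q a

/-- Bounded maps `A → A*` are determined by their values at the elements `{p, q}` of `A`. -/
theorem IsFull.deriv_ext (hM : M.IsFull) {D D' : A →L[ℂ] StrongDual ℂ A}
    (h : ∀ p q a, D a (M.pairA p q) = D' a (M.pairA p q)) : D = D' := by
  ext1 a
  exact hM.isoA.ext fun p q => h p q a

variable [IsScalarTower ℂ A A] [SMulCommClass ℂ A A]

theorem derivOfPotential_mem_Z1 (hM : M.IsFull) (ψ : M.potentials) :
    derivOfPotential hM ψ ∈ Z1 A := by
  intro a b x
  have h : derivOfPotential hM ψ (a * b) =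
      (derivOfPotential hM ψ b).comp ((ContinuousLinearMap.mul ℂ A).flip a) +
        (derivOfPotential hM ψ a).comp (ContinuousLinearMap.mul ℂ A b) := by
    refine hM.isoA.ext fun p q => ?_
    simp only [_root_.add_apply, ContinuousLinearMap.comp_apply, ContinuousLinearMap.flip_apply,
      ContinuousLinearMap.mul_apply', ← M.pairA_left, ← M.pairA_right, derivOfPotential_apply,
      M.modP.mul_left, M.modQ.right_mul]
    ring
  exact DFunLike.congr_fun h x

/-- The derivations of potentials, as a linear map. -/
def derivLinear (hM : M.IsFull) : M.potentials →ₗ[ℂ] Z1 A where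
  toFun ψ := ⟨derivOfPotential hM ψ, derivOfPotential_mem_Z1 hM ψ⟩
  map_add' ψ ψ' := by
    refine Subtype.ext (hM.deriv_ext fun p q a => ?_)
    simp only [Submodule.coe_add, _root_.add_apply, derivOfPotential_apply]
    ring
  map_smul' c ψ := by
    refine Subtype.ext (hM.deriv_ext fun p q a => ?_)
    simp only [Submodule.coe_smul, _root_.smul_apply, derivOfPotential_apply, RingHom.id_apply,
      smul_eq_mul]
    ring

/-! ### The first cohomology as a quotient of the space of potentials -/

/-- The map which sends a potential to the cohomology class of its derivation. -/
def classOfPotential (hM : M.IsFull) : M.potentials →ₗ[ℂ] H1 A :=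
  ((B1 A).submoduleOf (Z1 A)).mkQ ∘ₗ derivLinear hM

theorem range_classOfPotential (hM : M.IsFull) :
    LinearMap.range (classOfPotential hM) = M.H1M := by
  rw [classOfPotential, LinearMap.range_comp, H1M]
  congr 1
  ext D
  rw [Submodule.submoduleOf, Submodule.mem_comap]
  constructor
  · rintro ⟨ψ, rfl⟩
    exact ⟨derivOfPotential_mem_Z1 hM ψ, ψ.1, derivOfPotential_apply hM ψ⟩
  · rintro ⟨-, ψ, hψ⟩
    have hmem : ψ ∈ M.potentials := fun a b p q => by
      rw [← hψ, M.pairA_balanced, hψ, M.modQ.left_right]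
    refine ⟨⟨ψ, hmem⟩, Subtype.ext (hM.deriv_ext fun p q a => ?_)⟩
    exact (derivOfPotential_apply hM ⟨ψ, hmem⟩ p q a).trans (hψ p q a).symm

theorem mem_ker_classOfPotential (hM : M.IsFull) (ψ : M.potentials) :
    ψ ∈ LinearMap.ker (classOfPotential hM) ↔
      ∃ (f : StrongDual ℂ A) (g : StrongDual ℂ B),
        ∀ p q, ψ.1 p q = f (M.pairA p q) + g (M.pairB q p) := by
  rw [classOfPotential, LinearMap.mem_ker, LinearMap.comp_apply, Submodule.mkQ_apply,
    Submodule.Quotient.mk_eq_zero, Submodule.submoduleOf,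
    Submodule.mem_comap]
  change (∃ f : StrongDual ℂ A, ∀ a x, derivOfPotential hM ψ a x = f (x * a) - f (a * x)) ↔ _
  constructor
  · rintro ⟨f, hf⟩
    -- `ψ + f({·, ·})` is balanced over `A`, hence factors through `[·, ·]`.
    obtain ⟨g, hg⟩ := hM.isoB.exists_lift
      (ψ.1 + (ContinuousLinearMap.compL ℂ Q A ℂ f).comp M.pairA).flip (by
        intro q a p
        have h := derivOfPotential_apply hM ψ p q a
        rw [hf] at h
        simp only [ContinuousLinearMap.flip_apply, _root_.add_apply,
          ContinuousLinearMap.comp_apply, ContinuousLinearMap.compL_apply, M.pairA_left,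
          M.pairA_right]
        linear_combination h)
    refine ⟨-f, g, fun p q => ?_⟩
    rw [hg]
    simp
  · rintro ⟨f, g, h⟩
    refine ⟨-f, fun a x => ?_⟩
    have key : derivOfPotential hM ψ a =
        f.comp (ContinuousLinearMap.mul ℂ A a) -
          f.comp ((ContinuousLinearMap.mul ℂ A).flip a) := by
      refine hM.isoA.ext fun p q => ?_
      simp only [derivOfPotential_apply, h, M.pairA_left, M.pairA_right, M.pairB_balanced,
        _root_.sub_apply, ContinuousLinearMap.comp_apply, ContinuousLinearMap.flip_apply,
        ContinuousLinearMap.mul_apply']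
      ring
    rw [key]
    simp only [_root_.sub_apply, _root_.neg_apply, ContinuousLinearMap.comp_apply,
      ContinuousLinearMap.flip_apply, ContinuousLinearMap.mul_apply']
    ring

/-- The quotient of the potentials by the forms `f({·, ·}) + g([·, ·])` is isomorphic to `H1M`. -/
def quotientEquivH1M (hM : M.IsFull) :
    (M.potentials ⧸ LinearMap.ker (classOfPotential hM)) ≃ₗ[ℂ] M.H1M :=
  (classOfPotential hM).quotKerEquivRange.trans
    (LinearEquiv.ofEq _ _ (range_classOfPotential hM))

variable [IsScalarTower ℂ B B] [SMulCommClass ℂ B B]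

theorem map_potentialsFlip_ker (hM : M.IsFull) :
    (LinearMap.ker (classOfPotential hM)).map (M.potentialsFlip : M.potentials →ₗ[ℂ] _) =
      LinearMap.ker (classOfPotential hM.symm) := by
  ext ψ
  rw [Submodule.mem_map_equiv, mem_ker_classOfPotential, mem_ker_classOfPotential]
  constructor
  · rintro ⟨f, g, h⟩
    exact ⟨g, f, fun q p => (h p q).trans (add_comm _ _)⟩
  · rintro ⟨g, f, h⟩
    exact ⟨f, g, fun p q => (h q p).trans (add_comm _ _)⟩

end MoritaContext

end MoritaInvariance

end

theorem theorem2p13 {A B P Q : Type*}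
    [NonUnitalNormedRing A] [NormedSpace ℂ A] [IsScalarTower ℂ A A] [SMulCommClass ℂ A A]
    [CompleteSpace A]
    [NonUnitalNormedRing B] [NormedSpace ℂ B] [IsScalarTower ℂ B B] [SMulCommClass ℂ B B]
    [CompleteSpace B]
    [NormedAddCommGroup P] [NormedSpace ℂ P] [CompleteSpace P]
    [NormedAddCommGroup Q] [NormedSpace ℂ Q] [CompleteSpace Q]
    (hA : MoritaInvariance.IsSelfInduced A) (hB : MoritaInvariance.IsSelfInduced B)
    (M : MoritaInvariance.MoritaContext A B P Q) (hM : M.IsFull) :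
    Nonempty (M.H1M ≃ₗ[ℂ] M.symm.H1M) :=
  ⟨(MoritaInvariance.MoritaContext.quotientEquivH1M hM).symm.trans
    ((Submodule.Quotient.equiv _ _ M.potentialsFlip
      (MoritaInvariance.MoritaContext.map_potentialsFlip_ker hM)).trans
      (MoritaInvariance.MoritaContext.quotientEquivH1M hM.symm))⟩
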